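/- Let $a<b$ be real numbers. Let $x:[a,b]\to\mathbb R$ belong to $\mathbf N[a,b]$, i.e. $x$ is bounded and has at most countably many points of discontinuity, and let $g:[a,b]\to\mathbb R$ belong to $\mathbf{BV}[a,b]$, i.e. $g$ has finite total variation $\bigvee_a^b(g)$. For $h\in\mathbf{BV}[a,b]$ write $\sigma_t^+(h)=h(t+)-h(t)$, $\sigma_t^-(h)=h(t)-h(t-)$, $\sigma_t(h)=h(t+)-h(t-)$, let $T(h)$ be the set of discontinuity points of $h$, let $$h_d(a)=0,\qquad h_d(t)=\sigma_a^+(h)+\sum_{s\in T(h)\cap(a,t)}\sigma_s(h)+\sigma_t^-(h)\quad(a<t\le b),$$ and let $h_c=h-h_d$ be the continuous part of $h$. For $f\in\mathbf N[a,b]$ and $a<t\le b$ the $*$-integral is $$(*)\int_a^t f\,dh=\int_a^t f\,dh_c+\Bigl(f(a)\sigma_a^+(h)+\sum_{s\in T(h)\cap(a,t)}f(s)\sigma_s(h)+f(t)\sigma_t^-(h)\Bigr),$$ where the first term on the right is a Riemann–Stieltjes integral (limit of the sums $\sum_k f(\xi_k)(h_c(t_k)-h_c(t_{k-1}))$ as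 the diameter of the partition tends to $0$, for any choice of $\xi_k\in[t_{k-1},t_k]$), and $(*)\int_a^a f\,dh=0$. Put $g_\pi(a)=0$, $g_\pi(t)=\bigvee_a^t(g)$ for $a<t\le b$, and $$\Phi(t)=(*)\int_a^t x(s)\,dg(s),\qquad \Phi^{(\pi)}(t)=(*)\int_a^t x(s)\,dg_\pi(s)\qquad(a\le t\le b).$$ Then all these $*$-integrals and $(*)\int_a^b|x(t)|\,dg_\pi(t)$ are well defined (the Riemann–Stieltjes integrals exist and the series converge absolutely), $\Phi$ and $\Phi^{(\pi)}$ have finite total variation on $[a,b]$, and $$\bigvee_a^b(\Phi)=\bigvee_a^b(\Phi^{(\pi)})=(*)\int_a^b|x(t)|\,dg_\pi(t).$$ -/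

import Mathlib

open Set Filter Topology

noncomputable section

/-- Set of discontinuity points of `f : [a, b] → ℝ` (continuity is relative to `[a, b]`, so the
values of `f` outside `[a, b]` play no role). -/
def discSet (f : ℝ → ℝ) (a b : ℝ) : Set ℝ :=
  {t | t ∈ Icc a b ∧ ¬ ContinuousWithinAt f (Icc a b) t}

/-- The space `N[a, b]`: bounded functions on `[a, b]` with an at most countable set of
discontinuity points. -/
structure SigmaContinuousOn (f : ℝ → ℝ) (a b : ℝ) : Prop where
  bounded : ∃ C : ℝ, ∀ t ∈ Icc a b, |f t| ≤ C
  countable : (discSet f a b).Countable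

/-- Total variation of `f` on `[a, b]` as a real number (meaningful when
`BoundedVariationOn f (Icc a b)` holds, i.e. when the supremum is finite). -/
def totalVar (f : ℝ → ℝ) (a b : ℝ) : ℝ := (eVariationOn f (Icc a b)).toReal

/-- The variation function `f_π`: `f_π(a) = 0` and `f_π(t)` is the total variation of `f`
on `[a, t]` for `t > a`. -/
def varFun (f : ℝ → ℝ) (a : ℝ) : ℝ → ℝ := fun t => if t ≤ a then 0 else totalVar f a t

/-- Right jump `f(t+) - f(t)`. -/
def jumpRight (f : ℝ → ℝ) (t : ℝ) : ℝ := Function.rightLim f t - f t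

/-- Left jump `f(t) - f(t-)`. -/
def jumpLeft (f : ℝ → ℝ) (t : ℝ) : ℝ := f t - Function.leftLim f t

/-- Jump `f(t+) - f(t-)`. -/
def jump (f : ℝ → ℝ) (t : ℝ) : ℝ := Function.rightLim f t - Function.leftLim f t

/-- Discrete part of `g` on an interval with left endpoint `a`: it vanishes at `a`, and for `t > a`
it equals `σ_a^+(g) + ∑_{s ∈ T(g), a < s < t} σ_s(g) + σ_t^-(g)`. -/
def discPart (g : ℝ → ℝ) (a : ℝ) : ℝ → ℝ := fun t =>
  if t ≤ a then 0
  else jumpRight g a + (∑' s : ↥(discSet g a t ∩ Ioo a t), jump g s) + jumpLeft g t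

/-- Continuous part of `g`. -/
def contPart (g : ℝ → ℝ) (a : ℝ) : ℝ → ℝ := fun t => g t - discPart g a t

/-- `J` is the Riemann–Stieltjes integral of `f` with respect to `g` over `[a, b]`: the limit
of the sums `∑ f(ξ_k) (g(t_{k+1}) - g(t_k))` over tagged partitions `a = t_0 < ⋯ < t_n = b`,
`ξ_k ∈ [t_k, t_{k+1}]`, as the diameter of the partition tends to zero. -/
def HasRSIntegral (f g : ℝ → ℝ) (a b J : ℝ) : Prop :=
  ∀ ε > 0, ∃ δ > 0, ∀ (n : ℕ) (t ξ : ℕ → ℝ), t 0 = a → t n = b →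
    (∀ k < n, t k < t (k + 1) ∧ t (k + 1) - t k < δ ∧ ξ k ∈ Icc (t k) (t (k + 1))) →
    |∑ k ∈ Finset.range n, f (ξ k) * (g (t (k + 1)) - g (t k)) - J| < ε

open Classical in
/-- The value of the Riemann–Stieltjes integral (`0` if it does not exist). -/
def rsIntegral (f g : ℝ → ℝ) (a b : ℝ) : ℝ :=
  if h : ∃ J, HasRSIntegral f g a b J then h.choose else 0

/-- The constituents of the `*`-integral of `f` with respect to `g` over `[a, b]` make sense: the
Riemann–Stieltjes integral with respect to the continuous part exists, and the series over the
interior discontinuity points of `g` converges (absolutely). -/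
def StarIntegrable (f g : ℝ → ℝ) (a b : ℝ) : Prop :=
  (∃ J, HasRSIntegral f (contPart g a) a b J) ∧
    Summable fun s : ↥(discSet g a b ∩ Ioo a b) => f s * jump g s

/-- The `*`-integral `(*) ∫_a^b f dg`; it is `0` when `a = b`. -/
def starIntegral (f g : ℝ → ℝ) (a b : ℝ) : ℝ :=
  if a < b then
    rsIntegral f (contPart g a) a b +
      (f a * jumpRight g a + (∑' s : ↥(discSet g a b ∩ Ioo a b), f s * jump g s)
        + f b * jumpLeft g b)
  else 0

end

/-! Write g as a continuous function c of bounded variation plus a pure jump function with summable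
left and right jumps l, r. Variation is additive over this splitting
(`BoundedVariationOn.add_jumpFun`), so g_π splits into the variation V of c and the jump function of
|l|, |r|. The *-integral respects the splitting too (`JumpDecomposition.starIntegral`): Φ is F = ∫ x
dc plus the jump function of x·l, x·r, and Φ^(π) is K = ∫ x dV plus that of x|l|, x|r|. The jump
parts contribute the same Σ |x|(|l| + |r|) to both variations and to the integral of |x|, so
everything reduces to Var F = Var K = ∫ |x| dV.

For a continuous integrator, c is a difference of increasing continuous functions, hence of finite
atomless measures, for which x is continuous almost everywhere. Dominated convergence then makes the
absolute errors of Riemann–Stieltjes sums, added over the subintervals, small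
(`SigmaContinuousOn.exists_hasStrongRSIntegral`). Increments of F are bounded by those of ∫ |x| dV;
conversely, on fine uniform partitions Σ|Δc| nearly attains the variation of c, so Σ|ΔF| ≈ Σ|x||Δc|
≈ ∫ |x| dV (`HasStrongRSIntegral.variation_eq`). Since V is its own variation, the same lemma treats
K. -/

open MeasureTheory

/-! ### One-sided jumps of a function and of its variation -/

/-- `G` has left jumps `l` on `(a, b]` and right jumps `r` on `[a, b)`; the functions `l` and `r`
are extended by zero. -/
structure HasJumps (G l r : ℝ → ℝ) (a b : ℝ) : Prop where
  left : ∀ t ∈ Ioc a b, Tendsto G (𝓝[<] t) (𝓝 (G t - l t))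
  right : ∀ t ∈ Ico a b, Tendsto G (𝓝[>] t) (𝓝 (G t + r t))
  left_eq_zero : ∀ t ∉ Ioc a b, l t = 0
  right_eq_zero : ∀ t ∉ Ico a b, r t = 0

namespace HasJumps

variable {G H l r l' r' : ℝ → ℝ} {a b : ℝ}

theorem add (h : HasJumps G l r a b) (h' : HasJumps H l' r' a b) :
    HasJumps (fun t => G t + H t) (fun t => l t + l' t) (fun t => r t + r' t) a b where
  left t ht := by
    have := (h.left t ht).add (h'.left t ht)
    rwa [show G t - l t + (H t - l' t) = G t + H t - (l t + l' t) by ring] at this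
  right t ht := by
    have := (h.right t ht).add (h'.right t ht)
    rwa [show G t + r t + (H t + r' t) = G t + H t + (r t + r' t) by ring] at this
  left_eq_zero t ht := by simp [h.left_eq_zero t ht, h'.left_eq_zero t ht]
  right_eq_zero t ht := by simp [h.right_eq_zero t ht, h'.right_eq_zero t ht]

theorem neg (h : HasJumps G l r a b) :
    HasJumps (fun t => -G t) (fun t => -l t) (fun t => -r t) a b where
  left t ht := by
    have := (h.left t ht).neg
    rwa [show -(G t - l t) = -G t - -l t by ring] at this
  right t ht := by
    have := (h.right t ht).neg
    rwa [show -(G t + r t) = -G t + -r t by ring] at this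
  left_eq_zero t ht := by simp [h.left_eq_zero t ht]
  right_eq_zero t ht := by simp [h.right_eq_zero t ht]

theorem congr (h : HasJumps G l r a b) (hGH : EqOn G H (Icc a b)) : HasJumps H l r a b where
  left t ht := by
    rw [← hGH (Ioc_subset_Icc_self ht)]
    refine (h.left t ht).congr' ?_
    filter_upwards [Ico_mem_nhdsLT ht.1] with s hs
    exact hGH ⟨hs.1, hs.2.le.trans ht.2⟩
  right t ht := by
    rw [← hGH (Ico_subset_Icc_self ht)]
    refine (h.right t ht).congr' ?_
    filter_upwards [Ioc_mem_nhdsGT ht.2] with s hs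
    exact hGH ⟨ht.1.trans hs.1.le, hs.2⟩
  left_eq_zero := h.left_eq_zero
  right_eq_zero := h.right_eq_zero

/-- Splitting the interval at t separates the two one-sided conditions; at an endpoint the missing
side is a singleton, matching the zero extension of the jumps. -/
theorem continuousWithinAt_iff (h : HasJumps G l r a b) {t : ℝ} (ht : t ∈ Icc a b) :
    ContinuousWithinAt G (Icc a b) t ↔ l t = 0 ∧ r t = 0 := by
  rw [← Icc_union_Icc_eq_Icc ht.1 ht.2, continuousWithinAt_union]
  refine and_congr ?_ ?_
  · rcases ht.1.eq_or_lt with rfl | hat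
    · simp [h.left_eq_zero a, continuousWithinAt_singleton]
    · rw [continuousWithinAt_Icc_iff_Iic hat, ← continuousWithinAt_Iio_iff_Iic]
      have := h.left t ⟨hat, ht.2⟩
      refine ⟨fun h' => ?_, fun h' => by simpa [h'] using! this⟩
      linarith [tendsto_nhds_unique this h']
  · rcases ht.2.eq_or_lt with rfl | htb
    · simp [h.right_eq_zero t, continuousWithinAt_singleton]
    · rw [continuousWithinAt_Icc_iff_Ici htb, ← continuousWithinAt_Ioi_iff_Ici]
      have := h.right t ⟨ht.1, htb⟩
      refine ⟨fun h' => ?_, fun h' => by simpa [h'] using! this⟩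
      linarith [tendsto_nhds_unique this h']

theorem continuousOn (h : HasJumps G l r a b) (hl : ∀ t, l t = 0) (hr : ∀ t, r t = 0) :
    ContinuousOn G (Icc a b) := fun t ht => (h.continuousWithinAt_iff ht).2 ⟨hl t, hr t⟩

end HasJumps

theorem ContinuousOn.hasJumps_zero {c : ℝ → ℝ} {a b : ℝ} (hc : ContinuousOn c (Icc a b)) :
    HasJumps c (fun _ => 0) (fun _ => 0) a b where
  left t ht := by
    rw [sub_zero]
    exact (hc t (Ioc_subset_Icc_self ht)).mono_left
      (nhdsWithin_le_of_mem (mem_of_superset (Ico_mem_nhdsLT ht.1)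
        fun s hs => ⟨hs.1, hs.2.le.trans ht.2⟩))
  right t ht := by
    rw [add_zero]
    exact (hc t (Ico_subset_Icc_self ht)).mono_left
      (nhdsWithin_le_of_mem (mem_of_superset (Ioc_mem_nhdsGT ht.2)
        fun s hs => ⟨ht.1.trans hs.1.le, hs.2⟩))
  left_eq_zero _ _ := rfl
  right_eq_zero _ _ := rfl

theorem nhdsWithin_Icc_inter_Iio {a b t : ℝ} (ht : t ∈ Ioc a b) :
    𝓝[Icc a b ∩ Iio t] t = 𝓝[<] t :=
  nhdsWithin_inter_of_mem (mem_of_superset (Ico_mem_nhdsLT ht.1)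
    fun _ hs => ⟨hs.1, hs.2.le.trans ht.2⟩)

theorem nhdsWithin_Icc_inter_Ioi {a b t : ℝ} (ht : t ∈ Ico a b) :
    𝓝[Icc a b ∩ Ioi t] t = 𝓝[>] t :=
  nhdsWithin_inter_of_mem (mem_of_superset (Ioc_mem_nhdsGT ht.2)
    fun _ hs => ⟨ht.1.trans hs.1.le, hs.2⟩)

theorem BoundedVariationOn.exists_hasJumps {g : ℝ → ℝ} {a b : ℝ}
    (hg : BoundedVariationOn g (Icc a b)) : ∃ l r, HasJumps g l r a b := by
  classical
  choose L hL using hg.exists_tendsto_left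
  choose R hR using hg.exists_tendsto_right
  refine ⟨fun t => if t ∈ Ioc a b then g t - L t else 0,
    fun t => if t ∈ Ico a b then R t - g t else 0, ?_, ?_, ?_, ?_⟩
  · intro t ht
    have := hL t
    rw [nhdsWithin_Icc_inter_Iio ht] at this
    rwa [if_pos ht, sub_sub_cancel]
  · intro t ht
    have := hR t
    rw [nhdsWithin_Icc_inter_Ioi ht] at this
    rwa [if_pos ht, add_sub_cancel]
  · exact fun t ht => if_neg ht
  · exact fun t ht => if_neg ht

theorem HasJumps.variation {g l r : ℝ → ℝ} {a b : ℝ} (hg : BoundedVariationOn g (Icc a b))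
    (h : HasJumps g l r a b) :
    HasJumps (variationOnFromTo g (Icc a b) a) (fun t => |l t|) (fun t => |r t|) a b where
  left t ht := by
    have hab : a ≤ b := ht.1.le.trans ht.2
    have := variationOnFromTo.tendsto_left (left_mem_Icc.2 hab) (Ioc_subset_Icc_self ht)
      hg.locallyBoundedVariationOn (by rw [nhdsWithin_Icc_inter_Iio ht]; exact h.left t ht)
    rw [nhdsWithin_Icc_inter_Iio ht, Real.dist_eq] at this
    simpa using this
  right t ht := by
    have hab : a ≤ b := ht.1.trans ht.2.le
    have := variationOnFromTo.tendsto_right (left_mem_Icc.2 hab) (Ico_subset_Icc_self ht)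
      hg.locallyBoundedVariationOn (by rw [nhdsWithin_Icc_inter_Ioi ht]; exact h.right t ht)
    rw [nhdsWithin_Icc_inter_Ioi ht, Real.dist_eq] at this
    simpa using this
  left_eq_zero t ht := by simp [h.left_eq_zero t ht]
  right_eq_zero t ht := by simp [h.right_eq_zero t ht]

/-! ### Jumps of monotone functions -/

/-- The contribution of the jumps at `s` to the increment over `[u, v]`. -/
noncomputable def jumpIncr (l r : ℝ → ℝ) (u v s : ℝ) : ℝ :=
  (if u ≤ s ∧ s < v then r s else 0) + if u < s ∧ s ≤ v then l s else 0

/-- Freezing M outside [u, v] makes it monotone on the line and erases its left jump at u and right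
jump at v. The jumps are then the atoms of a Stieltjes measure giving [u, v] the mass M v - M u. -/
theorem HasJumps.sum_jumpIncr_le {M l r : ℝ → ℝ} {a b u v : ℝ} (h : HasJumps M l r a b)
    (hM : MonotoneOn M (Icc a b)) (hu : u ∈ Icc a b) (hv : v ∈ Icc a b) (huv : u ≤ v)
    (S : Finset ℝ) : ∑ s ∈ S, jumpIncr l r u v s ≤ M v - M u := by
  rcases huv.eq_or_lt with rfl | huv'
  · refine (Finset.sum_eq_zero fun s _ => ?_).trans_le (by simp)
    rw [jumpIncr, if_neg (by grind), if_neg (by grind), add_zero]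
  set N : ℝ → ℝ := fun t => M (projIcc u v huv t) with hN
  have hsub : Icc u v ⊆ Icc a b := Icc_subset_Icc hu.1 hv.2
  have hNm : Monotone N := fun s t hst =>
    hM (hsub (projIcc u v huv s).2) (hsub (projIcc u v huv t).2) (monotone_projIcc huv hst)
  have hNeq : ∀ t ∈ Icc u v, N t = M t := fun t ht => by simp [hN, projIcc_of_mem huv ht]
  have hNr : ∀ s ∈ Icc u v, N.rightLim s = N s + if u ≤ s ∧ s < v then r s else 0 := by
    intro s hs
    apply rightLim_eq_of_tendsto
    rcases hs.2.eq_or_lt with rfl | hsv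
    · refine tendsto_const_nhds.congr' ?_
      filter_upwards [self_mem_nhdsWithin] with t ht
      simp [hN, projIcc_of_right_le huv (mem_Ioi.1 ht).le]
    · rw [if_pos ⟨hs.1, hsv⟩, hNeq s hs]
      refine (h.right s ⟨hu.1.trans hs.1, hsv.trans_le hv.2⟩).congr' ?_
      filter_upwards [Ioc_mem_nhdsGT hsv] with t ht
      exact (hNeq t ⟨hs.1.trans ht.1.le, ht.2⟩).symm
  have hNl : ∀ s ∈ Icc u v, N.leftLim s = N s - if u < s ∧ s ≤ v then l s else 0 := by
    intro s hs
    apply leftLim_eq_of_tendsto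
    rcases hs.1.eq_or_lt with rfl | hsv
    · refine tendsto_const_nhds.congr' ?_
      filter_upwards [self_mem_nhdsWithin] with t ht
      simp [hN, projIcc_of_le_left huv (mem_Iio.1 ht).le]
    · rw [if_pos ⟨hsv, hs.2⟩, hNeq s hs]
      refine (h.left s ⟨hu.1.trans_lt hsv, hs.2.trans hv.2⟩).congr' ?_
      filter_upwards [Ico_mem_nhdsLT hsv] with t ht
      exact (hNeq t ⟨ht.1, ht.2.le.trans hs.2⟩).symm
  -- This is the right-continuous version of N; it has the same left limits, so the atom at s is the
  -- full jump of N.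
  set f := hNm.stieltjesFunction with hf
  have hfr : ∀ s, f s = N.rightLim s := fun s => hNm.stieltjesFunction_eq s
  have hfl : ∀ s, Function.leftLim f s = N.leftLim s := fun s => by
    have : (f : ℝ → ℝ) = N.rightLim := funext hfr
    rw [this]
    exact leftLim_rightLim (hNm.tendsto_leftLim s)
  have hjump : ∀ s ∈ Icc u v, f.measure {s} = ENNReal.ofReal (jumpIncr l r u v s) := by
    intro s hs
    rw [StieltjesFunction.measure_singleton, hfr, hfl, hNr s hs, hNl s hs, jumpIncr]
    congr 1
    ring
  have hnn : ∀ s ∈ Icc u v, 0 ≤ jumpIncr l r u v s := by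
    intro s hs
    have : N.leftLim s ≤ N.rightLim s := hNm.leftLim_le_rightLim le_rfl
    rw [hNr s hs, hNl s hs] at this
    rw [jumpIncr]
    linarith
  have hzero : ∀ s ∉ Icc u v, jumpIncr l r u v s = 0 := fun s hs => by
    rw [jumpIncr, if_neg (by grind), if_neg (by grind), add_zero]
  classical
  rw [← Finset.sum_filter_of_ne (p := (· ∈ Icc u v)) fun s _ hs => by
    by_contra h'
    exact hs (hzero s h')]
  rw [← ENNReal.ofReal_le_ofReal_iff (sub_nonneg.2 (hM hu hv huv)),
    ENNReal.ofReal_sum_of_nonneg fun s hs => hnn s (Finset.mem_filter.1 hs).2]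
  calc ∑ s ∈ S with s ∈ Icc u v, ENNReal.ofReal (jumpIncr l r u v s)
      = ∑ s ∈ S with s ∈ Icc u v, f.measure {s} :=
        Finset.sum_congr rfl fun s hs => (hjump s (Finset.mem_filter.1 hs).2).symm
    _ = f.measure (S.filter (· ∈ Icc u v) : Finset ℝ) := by
        rw [MeasureTheory.sum_measure_singleton]
    _ ≤ f.measure (Icc u v) :=
        MeasureTheory.measure_mono fun s hs => (Finset.mem_filter.1 hs).2
    _ = ENNReal.ofReal (M v - M u) := by
        rw [StieltjesFunction.measure_Icc, hfr, hfl, hNr v (right_mem_Icc.2 huv),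
          hNl u (left_mem_Icc.2 huv), hNeq u (left_mem_Icc.2 huv), hNeq v (right_mem_Icc.2 huv)]
        simp

theorem HasJumps.summable_of_monotoneOn {M l r : ℝ → ℝ} {a b : ℝ} (h : HasJumps M l r a b)
    (hM : MonotoneOn M (Icc a b)) (hl : ∀ t, 0 ≤ l t) (hr : ∀ t, 0 ≤ r t) (hab : a ≤ b) :
    Summable l ∧ Summable r := by
  have hle : ∀ s, l s + r s = jumpIncr l r a b s := by
    intro s
    rw [jumpIncr, add_comm]
    congr 1
    · split_ifs with hs
      exacts [rfl, h.right_eq_zero s hs]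
    · split_ifs with hs
      exacts [rfl, h.left_eq_zero s hs]
  have hsum : Summable fun s => l s + r s := by
    refine summable_of_sum_le (c := M b - M a) (fun s => add_nonneg (hl s) (hr s)) fun S => ?_
    simp only [hle]
    exact h.sum_jumpIncr_le hM (left_mem_Icc.2 hab) (right_mem_Icc.2 hab) hab S
  exact ⟨hsum.of_nonneg_of_le hl fun s => le_add_of_nonneg_right (hr s),
    hsum.of_nonneg_of_le hr fun s => le_add_of_nonneg_left (hl s)⟩

/-! ### Pure jump functions -/

/-- The pure jump function with left jumps `l` and right jumps `r`. -/
noncomputable def jumpFun (l r : ℝ → ℝ) (t : ℝ) : ℝ :=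
  ∑' s, ((if s < t then r s else 0) + if s ≤ t then l s else 0)

section jumpFun

variable {l r l' r' : ℝ → ℝ} {a b : ℝ}

theorem Summable.ite_zero {f : ℝ → ℝ} (hf : Summable f) (p : ℝ → Prop) [DecidablePred p] :
    Summable fun s => if p s then f s else 0 := by
  refine hf.abs.of_norm_bounded fun s => ?_
  split_ifs <;> simp

theorem jumpFun_sub_jumpFun (hl : Summable l) (hr : Summable r) {u v : ℝ} (huv : u ≤ v) :
    jumpFun l r v - jumpFun l r u = ∑' s, jumpIncr l r u v s := by
  rw [jumpFun, jumpFun, ← Summable.tsum_sub ((hr.ite_zero _).add (hl.ite_zero _))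
    ((hr.ite_zero _).add (hl.ite_zero _))]
  refine tsum_congr fun s => ?_
  rw [jumpIncr]
  grind

theorem summable_jumpIncr (hl : Summable l) (hr : Summable r) (u v : ℝ) :
    Summable (jumpIncr l r u v) := (hr.ite_zero _).add (hl.ite_zero _)

theorem jumpFun_add (hl : Summable l) (hr : Summable r) (hl' : Summable l') (hr' : Summable r')
    (t : ℝ) : jumpFun (fun s => l s + l' s) (fun s => r s + r' s) t =
      jumpFun l r t + jumpFun l' r' t := by
  rw [jumpFun, jumpFun, jumpFun, ← Summable.tsum_add ((hr.ite_zero _).add (hl.ite_zero _))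
    ((hr'.ite_zero _).add (hl'.ite_zero _))]
  refine tsum_congr fun s => ?_
  grind

theorem jumpFun_neg (t : ℝ) : jumpFun (fun s => -l s) (fun s => -r s) t = -jumpFun l r t := by
  rw [jumpFun, jumpFun, ← tsum_neg]
  refine tsum_congr fun s => ?_
  grind

theorem jumpFun_left (hl0 : ∀ t ∉ Ioc a b, l t = 0) (hr0 : ∀ t ∉ Ico a b, r t = 0) :
    jumpFun l r a = 0 := by
  rw [jumpFun]
  refine (tsum_congr fun s => ?_).trans tsum_zero
  have := hl0 s
  have := hr0 s
  grind

theorem abs_jumpFun_sub_le (hl : Summable l) (hr : Summable r) {u v : ℝ} (huv : u ≤ v) :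
    |jumpFun l r v - jumpFun l r u| ≤
      jumpFun (fun s => |l s|) (fun s => |r s|) v - jumpFun (fun s => |l s|) (fun s => |r s|) u := by
  rw [jumpFun_sub_jumpFun hl hr huv, jumpFun_sub_jumpFun hl.abs hr.abs huv]
  have hle : ∀ s, ‖jumpIncr l r u v s‖ ≤ jumpIncr (fun s => |l s|) (fun s => |r s|) u v s := by
    intro s
    simp only [jumpIncr]
    refine (norm_add_le _ _).trans (add_le_add ?_ ?_) <;> split_ifs <;> simp
  exact tsum_of_norm_bounded (summable_jumpIncr hl.abs hr.abs u v).hasSum hle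

/-- As t' tends to t from one side, each term of the series is eventually constant, and |r| + |l| is
a summable majorant. The limit series differs from the value at t only in the term s = t. -/
theorem hasJumps_jumpFun (hl : Summable l) (hr : Summable r) (hl0 : ∀ t ∉ Ioc a b, l t = 0)
    (hr0 : ∀ t ∉ Ico a b, r t = 0) : HasJumps (jumpFun l r) l r a b where
  left t _ := by
    have key : ∑' s, ((if s < t then r s else 0) + if s < t then l s else 0) =
        jumpFun l r t - l t := by
      rw [← tsum_ite_eq t (fun _ => l t), jumpFun, ← Summable.tsum_sub
        ((hr.ite_zero _).add (hl.ite_zero _)) (hasSum_ite_eq t (l t)).summable]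
      refine tsum_congr fun s => ?_
      grind
    rw [← key]
    refine tendsto_tsum_of_dominated_convergence (hr.abs.add hl.abs) (fun s => ?_)
      (Eventually.of_forall fun t' s => ?_)
    · refine tendsto_const_nhds.congr' ?_
      rcases lt_or_ge s t with hs | hs
      · filter_upwards [Ioo_mem_nhdsLT hs] with t' ht'
        grind
      · filter_upwards [self_mem_nhdsWithin] with t' ht'
        grind
    · refine (norm_add_le _ _).trans (add_le_add ?_ ?_) <;> split_ifs <;> simp
  right t _ := by
    have key : ∑' s, ((if s ≤ t then r s else 0) + if s ≤ t then l s else 0) =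
        jumpFun l r t + r t := by
      rw [← tsum_ite_eq t (fun _ => r t), jumpFun, ← Summable.tsum_add
        ((hr.ite_zero _).add (hl.ite_zero _)) (hasSum_ite_eq t (r t)).summable]
      refine tsum_congr fun s => ?_
      grind
    rw [← key]
    refine tendsto_tsum_of_dominated_convergence (hr.abs.add hl.abs) (fun s => ?_)
      (Eventually.of_forall fun t' s => ?_)
    · refine tendsto_const_nhds.congr' ?_
      rcases lt_or_ge t s with hs | hs
      · filter_upwards [Ioo_mem_nhdsGT hs] with t' ht'
        grind
      · filter_upwards [self_mem_nhdsWithin] with t' ht'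
        grind
    · refine (norm_add_le _ _).trans (add_le_add ?_ ?_) <;> split_ifs <;> simp
  left_eq_zero := hl0
  right_eq_zero := hr0

end jumpFun

/-- Equivalently, a monotone function stays monotone once its jumps are removed; this drives the
lower bound for the variation of a sum. -/
theorem HasJumps.jumpFun_sub_le {M l r : ℝ → ℝ} {a b u v : ℝ} (h : HasJumps M l r a b)
    (hM : MonotoneOn M (Icc a b)) (hl : Summable l) (hr : Summable r)
    (hu : u ∈ Icc a b) (hv : v ∈ Icc a b) (huv : u ≤ v) :
    jumpFun l r v - jumpFun l r u ≤ M v - M u := by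
  rw [jumpFun_sub_jumpFun hl hr huv]
  exact (summable_jumpIncr hl hr u v).tsum_le_of_sum_le
    fun S => h.sum_jumpIncr_le hM hu hv huv S

/-! ### Variation of a continuous function plus a jump function -/

section variation

variable {G m : ℝ → ℝ} {a b : ℝ}

theorem eVariationOn_Icc_le_ofReal
    (h : ∀ u ∈ Icc a b, ∀ v ∈ Icc a b, u ≤ v → |G v - G u| ≤ m v - m u) (hab : a ≤ b) :
    eVariationOn G (Icc a b) ≤ ENNReal.ofReal (m b - m a) := by
  have hm : MonotoneOn m (Icc a b) := fun u hu v hv huv =>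
    sub_nonneg.1 ((abs_nonneg _).trans (h u hu v hv huv))
  refine le_trans ?_ (by simpa using
    (hm.eVariationOn_eq (left_mem_Icc.2 hab) (right_mem_Icc.2 hab)).le)
  refine iSup_le fun ⟨n, u, hu, hus⟩ => ?_
  refine (Finset.sum_le_sum fun i _ => ?_).trans (eVariationOn.sum_le (f := m) hu hus)
  rw [edist_dist, edist_dist, Real.dist_eq, Real.dist_eq]
  exact ENNReal.ofReal_le_ofReal ((h _ (hus i) _ (hus (i + 1)) (hu i.le_succ)).trans
    (le_abs_self _))

theorem variationOnFromTo_Icc {t : ℝ} (ht : t ∈ Icc a b) :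
    variationOnFromTo G (Icc a b) a t = (eVariationOn G (Icc a t)).toReal := by
  rw [variationOnFromTo.eq_of_le _ _ ht.1, inter_eq_right.2 (Icc_subset_Icc_right ht.2)]

theorem variationOnFromTo_Icc_le
    (h : ∀ u ∈ Icc a b, ∀ v ∈ Icc a b, u ≤ v → |G v - G u| ≤ m v - m u) {t : ℝ}
    (ht : t ∈ Icc a b) : variationOnFromTo G (Icc a b) a t ≤ m t - m a := by
  have hsub : Icc a t ⊆ Icc a b := Icc_subset_Icc_right ht.2
  rw [variationOnFromTo_Icc ht]
  exact ENNReal.toReal_le_of_le_ofReal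
    ((abs_nonneg _).trans (h a (left_mem_Icc.2 (ht.1.trans ht.2)) t ht ht.1))
    (eVariationOn_Icc_le_ofReal (fun u hu v hv => h u (hsub hu) v (hsub hv)) ht.1)

theorem boundedVariationOn_Icc_of_abs_sub_le
    (h : ∀ u ∈ Icc a b, ∀ v ∈ Icc a b, u ≤ v → |G v - G u| ≤ m v - m u) (hab : a ≤ b) :
    BoundedVariationOn G (Icc a b) :=
  ne_top_of_le_ne_top ENNReal.ofReal_ne_top (eVariationOn_Icc_le_ofReal h hab)

variable {c l r : ℝ → ℝ}

/-- The variation of the sum of a continuous function and a pure jump function is the sum of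
the variations. -/
theorem BoundedVariationOn.add_jumpFun (hab : a ≤ b) (hc : ContinuousOn c (Icc a b))
    (hcv : BoundedVariationOn c (Icc a b)) (hl : Summable l) (hr : Summable r)
    (hl0 : ∀ t ∉ Ioc a b, l t = 0) (hr0 : ∀ t ∉ Ico a b, r t = 0) :
    BoundedVariationOn (fun t => c t + jumpFun l r t) (Icc a b) ∧
    ∀ t ∈ Icc a b, variationOnFromTo (fun t => c t + jumpFun l r t) (Icc a b) a t =
      variationOnFromTo c (Icc a b) a t + jumpFun (fun s => |l s|) (fun s => |r s|) t := by
  set G : ℝ → ℝ := fun t => c t + jumpFun l r t with hG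
  set J : ℝ → ℝ := jumpFun (fun s => |l s|) (fun s => |r s|) with hJ
  have ha : a ∈ Icc a b := left_mem_Icc.2 hab
  have hJa : J a = 0 := jumpFun_left (b := b) (fun t ht => by simp [hl0 t ht])
    (fun t ht => by simp [hr0 t ht])
  have hbound : ∀ u ∈ Icc a b, ∀ v ∈ Icc a b, u ≤ v → |G v - G u| ≤
      (variationOnFromTo c (Icc a b) a v + J v) - (variationOnFromTo c (Icc a b) a u + J u) := by
    intro u hu v hv huv
    have h1 := variationOnFromTo.abs_sub_le_sub_of_le hcv.locallyBoundedVariationOn ha hu hv huv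
    have h2 := abs_jumpFun_sub_le hl hr huv
    rw [show G v - G u = (c v - c u) + (jumpFun l r v - jumpFun l r u) by simp only [hG]; ring]
    linarith [abs_add_le (c v - c u) (jumpFun l r v - jumpFun l r u)]
  have hGv : BoundedVariationOn G (Icc a b) := boundedVariationOn_Icc_of_abs_sub_le hbound hab
  refine ⟨hGv, fun t ht => le_antisymm ?_ ?_⟩
  · have := variationOnFromTo_Icc_le hbound ht
    rwa [hJa, variationOnFromTo.self, add_zero, sub_zero] at this
  set V := variationOnFromTo G (Icc a b) a with hV
  have hGj : HasJumps G l r a b := by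
    simpa using! hc.hasJumps_zero.add (hasJumps_jumpFun hl hr hl0 hr0)
  have hVj := hGj.variation hGv
  -- Both V + G and V - G are monotone, with jumps |l| ± l and |r| ± r. Removing these leaves V - J
  -- ± c monotone, so c varies by at most V - J.
  have hcW : ∀ u ∈ Icc a b, ∀ v ∈ Icc a b, u ≤ v → |c v - c u| ≤ (V v - J v) - (V u - J u) := by
    intro u hu v hv huv
    have h1 := (hVj.add hGj).jumpFun_sub_le
      (variationOnFromTo.add_self_monotoneOn hGv.locallyBoundedVariationOn ha)
      (hl.abs.add hl) (hr.abs.add hr) hu hv huv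
    have h2 := (hVj.add hGj.neg).jumpFun_sub_le
      (by simpa only [sub_eq_add_neg] using!
        variationOnFromTo.sub_self_monotoneOn hGv.locallyBoundedVariationOn ha)
      (hl.abs.add hl.neg) (hr.abs.add hr.neg) hu hv huv
    rw [jumpFun_add hl.abs hr.abs hl hr, jumpFun_add hl.abs hr.abs hl hr] at h1
    rw [jumpFun_add hl.abs hr.abs hl.neg hr.neg, jumpFun_add hl.abs hr.abs hl.neg hr.neg,
      jumpFun_neg, jumpFun_neg] at h2
    rw [abs_le]
    simp only [hG] at h1 h2
    constructor <;> linarith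
  have := variationOnFromTo_Icc_le hcW ht
  rw [hJa, hV, variationOnFromTo.self] at this
  linarith

theorem continuousOn_variationOnFromTo (hc : ContinuousOn c (Icc a b))
    (hcv : BoundedVariationOn c (Icc a b)) :
    ContinuousOn (variationOnFromTo c (Icc a b) a) (Icc a b) :=
  (hc.hasJumps_zero.variation hcv).continuousOn (fun _ => abs_zero) fun _ => abs_zero

/-- Decomposition of a function of bounded variation into its continuous part and jump part. -/
theorem BoundedVariationOn.exists_eq_add_jumpFun {g : ℝ → ℝ} (hab : a ≤ b)
    (hg : BoundedVariationOn g (Icc a b)) :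
    ∃ c l r, ContinuousOn c (Icc a b) ∧ BoundedVariationOn c (Icc a b) ∧ Summable l ∧
      Summable r ∧ (∀ t ∉ Ioc a b, l t = 0) ∧ (∀ t ∉ Ico a b, r t = 0) ∧
      ∀ t, g t = c t + jumpFun l r t := by
  obtain ⟨l, r, h⟩ := hg.exists_hasJumps
  have ha : a ∈ Icc a b := left_mem_Icc.2 hab
  obtain ⟨hl, hr⟩ := (h.variation hg).summable_of_monotoneOn
    (variationOnFromTo.monotoneOn hg.locallyBoundedVariationOn ha)
    (fun _ => abs_nonneg _) (fun _ => abs_nonneg _) hab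
  rw [summable_abs_iff] at hl hr
  have hj := hasJumps_jumpFun hl hr h.left_eq_zero h.right_eq_zero
  refine ⟨fun t => g t + -jumpFun l r t, l, r, ?_, ?_, hl, hr, h.left_eq_zero, h.right_eq_zero,
    fun t => by ring⟩
  · exact (h.add hj.neg).continuousOn (fun t => by simp) fun t => by simp
  · refine boundedVariationOn_Icc_of_abs_sub_le (m := fun t => variationOnFromTo g (Icc a b) a t +
      jumpFun (fun s => |l s|) (fun s => |r s|) t) (fun u hu v hv huv => ?_) hab
    have h1 := variationOnFromTo.abs_sub_le_sub_of_le hg.locallyBoundedVariationOn ha hu hv huv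
    have h2 := abs_jumpFun_sub_le hl hr huv
    rw [show g v + -jumpFun l r v - (g u + -jumpFun l r u) =
      (g v - g u) - (jumpFun l r v - jumpFun l r u) by ring]
    linarith [abs_sub (g v - g u) (jumpFun l r v - jumpFun l r u)]

end variation

/-! ### Tagged partitions and Riemann–Stieltjes integrals -/

/-- Tagged partition of `[a, b]` with `n` subintervals, of diameter less than `δ`. -/
def IsTaggedPartition (a b δ : ℝ) (n : ℕ) (t ξ : ℕ → ℝ) : Prop :=
  t 0 = a ∧ t n = b ∧
    ∀ k < n, t k < t (k + 1) ∧ t (k + 1) - t k < δ ∧ ξ k ∈ Icc (t k) (t (k + 1))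

namespace IsTaggedPartition

variable {a b δ δ' : ℝ} {n : ℕ} {t ξ : ℕ → ℝ}

theorem mono (h : IsTaggedPartition a b δ n t ξ) (hδ : δ ≤ δ') : IsTaggedPartition a b δ' n t ξ :=
  ⟨h.1, h.2.1, fun k hk => ⟨(h.2.2 k hk).1, (h.2.2 k hk).2.1.trans_le hδ, (h.2.2 k hk).2.2⟩⟩

theorem monotoneOn (h : IsTaggedPartition a b δ n t ξ) : MonotoneOn t (Iic n) := by
  intro i _ j hj hij
  induction j, hij using Nat.le_induction with
  | base => exact le_rfl
  | succ j hij ih =>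
    have hj : j < n := hj
    exact (ih (mem_Iic.2 hj.le)).trans (h.2.2 j hj).1.le

theorem mem_Icc (h : IsTaggedPartition a b δ n t ξ) {k : ℕ} (hk : k ≤ n) : t k ∈ Icc a b :=
  ⟨h.1 ▸ h.monotoneOn (mem_Iic.2 n.zero_le) (mem_Iic.2 hk) k.zero_le,
    h.2.1 ▸ h.monotoneOn (mem_Iic.2 hk) (mem_Iic.2 le_rfl) hk⟩

theorem Icc_subset (h : IsTaggedPartition a b δ n t ξ) {k : ℕ} (hk : k < n) :
    Icc (t k) (t (k + 1)) ⊆ Icc a b :=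
  Icc_subset_Icc (h.mem_Icc hk.le).1 (h.mem_Icc (Nat.succ_le_of_lt hk)).2

theorem eq_of_mem_Ioc (h : IsTaggedPartition a b δ n t ξ) {y : ℝ} {j k : ℕ} (hj : j < n)
    (hk : k < n) (hyj : y ∈ Ioc (t j) (t (j + 1))) (hyk : y ∈ Ioc (t k) (t (k + 1))) : j = k := by
  by_contra hne
  rcases Nat.lt_or_gt_of_ne hne with hlt | hlt
  · have := h.monotoneOn (mem_Iic.2 (Nat.succ_le_of_lt hj)) (mem_Iic.2 hk.le) hlt
    linarith [hyj.2, hyk.1]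
  · have := h.monotoneOn (mem_Iic.2 (Nat.succ_le_of_lt hk)) (mem_Iic.2 hj.le) hlt
    linarith [hyk.2, hyj.1]

theorem uniform (hab : a < b) (N : ℕ) (hN : (b - a) / (N + 1) < δ) :
    IsTaggedPartition a b δ (N + 1) (fun k => a + k * ((b - a) / (N + 1)))
      (fun k => a + k * ((b - a) / (N + 1))) := by
  have hpos : 0 < (b - a) / (N + 1 : ℝ) := div_pos (sub_pos.2 hab) (by positivity)
  refine ⟨by simp, ?_, fun k _ => ?_⟩
  · push_cast
    field_simp
    ring
  · push_cast
    refine ⟨by linarith, by linarith, le_rfl, by linarith⟩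

end IsTaggedPartition

theorem eventually_div_lt (a b : ℝ) {δ : ℝ} (hδ : 0 < δ) :
    ∀ᶠ N : ℕ in atTop, (b - a) / (N + 1 : ℝ) < δ := by
  have : Tendsto (fun N : ℕ => (b - a) / ((N : ℝ) + 1)) atTop (𝓝 0) :=
    tendsto_const_nhds.div_atTop
      (tendsto_atTop_add_const_right _ _ tendsto_natCast_atTop_atTop)
  exact this.eventually_lt_const hδ

theorem exists_isTaggedPartition {a b δ : ℝ} (hab : a ≤ b) (hδ : 0 < δ) :
    ∃ n t ξ, IsTaggedPartition a b δ n t ξ := by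
  rcases hab.eq_or_lt with rfl | hab
  · exact ⟨0, fun _ => a, fun _ => a, rfl, rfl, fun k hk => absurd hk k.not_lt_zero⟩
  · obtain ⟨N, hN⟩ := (eventually_div_lt a b hδ).exists
    exact ⟨_, _, _, IsTaggedPartition.uniform hab N hN⟩

theorem HasRSIntegral.unique {f g : ℝ → ℝ} {a b J J' : ℝ} (hab : a ≤ b)
    (h : HasRSIntegral f g a b J) (h' : HasRSIntegral f g a b J') : J = J' := by
  by_contra hne
  have hpos : 0 < |J - J'| / 2 := by have := abs_pos.2 (sub_ne_zero.2 hne); positivity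
  obtain ⟨δ, hδ, h⟩ := h _ hpos
  obtain ⟨δ', hδ', h'⟩ := h' _ hpos
  obtain ⟨n, t, ξ, hP⟩ := exists_isTaggedPartition hab (lt_min hδ hδ')
  have hP1 := hP.mono (min_le_left _ _)
  have hP2 := hP.mono (min_le_right _ _)
  have h1 := h n t ξ hP1.1 hP1.2.1 hP1.2.2
  have h2 := h' n t ξ hP2.1 hP2.2.1 hP2.2.2
  set S := ∑ k ∈ Finset.range n, f (ξ k) * (g (t (k + 1)) - g (t k))
  have := abs_sub_le J S J'
  rw [abs_sub_comm J S] at this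
  linarith

theorem HasRSIntegral.congr {f g g' : ℝ → ℝ} {a b J : ℝ} (h : HasRSIntegral f g a b J)
    (hg : EqOn g g' (Icc a b)) : HasRSIntegral f g' a b J := by
  intro ε hε
  obtain ⟨δ, hδ, h⟩ := h ε hε
  refine ⟨δ, hδ, fun n t ξ h0 hn hk => ?_⟩
  have hP : IsTaggedPartition a b δ n t ξ := ⟨h0, hn, hk⟩
  have := h n t ξ h0 hn hk
  rwa [Finset.sum_congr rfl fun k hk => by
    rw [hg (hP.mem_Icc (Finset.mem_range.1 hk).le),
      hg (hP.mem_Icc (Nat.succ_le_of_lt (Finset.mem_range.1 hk)))]] at this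

theorem HasRSIntegral.rsIntegral_eq {f g : ℝ → ℝ} {a b J : ℝ} (hab : a ≤ b)
    (h : HasRSIntegral f g a b J) : rsIntegral f g a b = J := by
  have hex : ∃ J, HasRSIntegral f g a b J := ⟨J, h⟩
  rw [rsIntegral, dif_pos hex]
  exact hex.choose_spec.unique hab h

/-! ### Almost everywhere continuous integrands and atomless measures -/

section measure

variable {a b : ℝ} {x : ℝ → ℝ}

theorem discSet_subset_discSet {u v : ℝ} (hu : a ≤ u) (hv : v ≤ b) :
    discSet x u v ⊆ discSet x a b :=
  fun _ ht => ⟨Icc_subset_Icc hu hv ht.1, fun h => ht.2 (h.mono (Icc_subset_Icc hu hv))⟩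

theorem SigmaContinuousOn.mono (hx : SigmaContinuousOn x a b) {u v : ℝ} (hu : a ≤ u)
    (hv : v ≤ b) : SigmaContinuousOn x u v :=
  ⟨hx.bounded.imp fun _ hC t ht => hC t (Icc_subset_Icc hu hv ht),
    hx.countable.mono (discSet_subset_discSet hu hv)⟩

theorem discSet_abs_subset : discSet (fun t => |x t|) a b ⊆ discSet x a b :=
  fun _ ht => ⟨ht.1, fun h => ht.2 (ContinuousWithinAt.abs h)⟩

theorem SigmaContinuousOn.abs (hx : SigmaContinuousOn x a b) :
    SigmaContinuousOn (fun t => |x t|) a b :=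
  ⟨hx.bounded.imp fun _ hC t ht => by rw [abs_abs]; exact hC t ht,
    hx.countable.mono discSet_abs_subset⟩

/-- Without atoms the countable discontinuity set is null, and off it x is continuous, hence
measurable; boundedness does the rest. -/
theorem SigmaContinuousOn.integrableOn (hx : SigmaContinuousOn x a b) (ν : Measure ℝ)
    [IsFiniteMeasure ν] [NullSingletonClass ν] : IntegrableOn x (Icc a b) ν := by
  obtain ⟨C, hC⟩ := hx.bounded
  have hcont : ContinuousOn x (Icc a b \ discSet x a b) := fun t ht =>
    (not_not.1 fun h => ht.2 ⟨ht.1, h⟩ : ContinuousWithinAt x (Icc a b) t).mono sdiff_subset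
  have hmeas : AEStronglyMeasurable x (ν.restrict (Icc a b)) := by
    rw [← Measure.restrict_congr_set (sdiff_null_ae_eq_self (hx.countable.measure_zero ν))]
    exact hcont.aestronglyMeasurable (measurableSet_Icc.diff hx.countable.measurableSet)
  exact Integrable.of_bound hmeas C
    ((ae_restrict_iff' measurableSet_Icc).2 (Eventually.of_forall hC))

/-- The mean oscillation of `x` over fine partitions tends to zero. -/
theorem SigmaContinuousOn.exists_sum_setIntegral_lt (hx : SigmaContinuousOn x a b)
    (ν : Measure ℝ) [IsFiniteMeasure ν] [NullSingletonClass ν] {ε : ℝ} (hε : 0 < ε) :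
    ∃ δ > 0, ∀ n t ξ, IsTaggedPartition a b δ n t ξ →
      ∑ k ∈ Finset.range n, ∫ y in Ioc (t k) (t (k + 1)), |x y - x (ξ k)| ∂ν < ε := by
  -- Otherwise there are partitions of diameter below 1/(m+1) with oscillation at least ε. The
  -- oscillation functions `F m` below are bounded by 2|C| and tend to zero at every continuity
  -- point of x, contradicting dominated convergence.
  by_contra! H
  choose n t ξ hP hge using fun m : ℕ => H (1 / ((m : ℝ) + 1)) Nat.one_div_pos_of_nat
  obtain ⟨C, hC⟩ := hx.bounded
  have hint : ∀ m, ∀ k ∈ Finset.range (n m), Integrable ((Ioc (t m k) (t m (k + 1))).indicator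
      fun y => |x y - x (ξ m k)|) ν := by
    intro m k hk
    rw [integrable_indicator_iff measurableSet_Ioc]
    exact (((hx.integrableOn ν).mono_set (Ioc_subset_Icc_self.trans
      ((hP m).Icc_subset (Finset.mem_range.1 hk)))).sub (integrable_const _)).abs
  set F : ℕ → ℝ → ℝ := fun m y => ∑ k ∈ Finset.range (n m),
    (Ioc (t m k) (t m (k + 1))).indicator (fun y => |x y - x (ξ m k)|) y with hF
  have hFint : ∀ m, ∫ y, F m y ∂ν = ∑ k ∈ Finset.range (n m),
      ∫ y in Ioc (t m k) (t m (k + 1)), |x y - x (ξ m k)| ∂ν := by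
    intro m
    rw [integral_finsetSum _ (hint m)]
    exact Finset.sum_congr rfl fun k _ => integral_indicator measurableSet_Ioc
  -- The half-open pieces are disjoint, so at most one summand is nonzero at y; the tag of that
  -- piece serves as z.
  have hFcases : ∀ m y, F m y = 0 ∨ ∃ z ∈ Icc a b, y ∈ Icc a b ∧ |z - y| < 1 / ((m : ℝ) + 1) ∧
      F m y = |x y - x z| := by
    intro m y
    by_cases hy : ∃ k < n m, y ∈ Ioc (t m k) (t m (k + 1))
    · obtain ⟨k, hk, hyk⟩ := hy
      obtain ⟨-, h2, h3⟩ := (hP m).2.2 k hk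
      refine Or.inr ⟨ξ m k, (hP m).Icc_subset hk h3,
        (hP m).Icc_subset hk (Ioc_subset_Icc_self hyk), ?_, ?_⟩
      · rw [abs_lt]
        constructor <;> linarith [hyk.1, hyk.2, h3.1, h3.2]
      · simp only [hF]
        rw [Finset.sum_eq_single k, indicator_of_mem hyk]
        · exact fun j hj hjk => indicator_of_notMem (fun hyj =>
            hjk ((hP m).eq_of_mem_Ioc (Finset.mem_range.1 hj) hk hyj hyk)) _
        · exact fun h => absurd (Finset.mem_range.2 hk) h
    · push Not at hy
      exact Or.inl (Finset.sum_eq_zero fun k hk =>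
        indicator_of_notMem (hy k (Finset.mem_range.1 hk)) _)
  have hlim : Tendsto (fun m => ∫ y, F m y ∂ν) atTop (𝓝 (∫ _, (0 : ℝ) ∂ν)) := by
    refine tendsto_integral_of_dominated_convergence (fun _ => |C| + |C|)
      (fun m => (integrable_finsetSum _ (hint m)).aestronglyMeasurable)
      (integrable_const _) (fun m => Eventually.of_forall fun y => ?_) ?_
    · rcases hFcases m y with h | ⟨z, hz, hy, -, h⟩
      · rw [h, norm_zero]
        positivity
      · rw [h, Real.norm_eq_abs, abs_abs]
        exact (abs_sub _ _).trans (add_le_add ((hC y hy).trans (le_abs_self C))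
          ((hC z hz).trans (le_abs_self C)))
    · filter_upwards [hx.countable.ae_notMem ν] with y hy
      rw [Metric.tendsto_atTop]
      intro η hη
      by_cases hyI : y ∈ Icc a b
      · have hcont : ContinuousWithinAt x (Icc a b) y := not_not.1 fun h => hy ⟨hyI, h⟩
        obtain ⟨d, hd, hcd⟩ := Metric.continuousWithinAt_iff.1 hcont η hη
        obtain ⟨N, hN⟩ := exists_nat_one_div_lt hd
        refine ⟨N, fun m hm => ?_⟩
        rcases hFcases m y with h | ⟨z, hz, -, hzy, h⟩
        · simpa [h] using hη
        · rw [h, Real.dist_eq, sub_zero, abs_abs, abs_sub_comm, ← Real.dist_eq]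
          refine hcd hz ?_
          rw [Real.dist_eq]
          exact hzy.trans ((Nat.one_div_le_one_div hm).trans_lt hN)
      · refine ⟨0, fun m _ => ?_⟩
        rcases hFcases m y with h | ⟨z, hz, hy', -⟩
        · simpa [h] using hη
        · exact absurd hy' hyI
  rw [integral_zero] at hlim
  obtain ⟨m, hm⟩ := (hlim.eventually_lt_const hε).exists
  rw [hFint] at hm
  exact absurd hm (not_lt.2 (hge m))

/-- The Stieltjes measure of m frozen outside [a, b]: boundedness makes it finite, continuity
removes the atoms. -/
theorem MonotoneOn.exists_measure {m : ℝ → ℝ} (hab : a ≤ b) (hm : MonotoneOn m (Icc a b))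
    (hc : ContinuousOn m (Icc a b)) :
    ∃ μ : Measure ℝ, IsFiniteMeasure μ ∧ NullSingletonClass μ ∧
      ∀ u ∈ Icc a b, ∀ v ∈ Icc a b, u ≤ v → μ.real (Ioc u v) = m v - m u := by
  have hcont : Continuous fun t => m (projIcc a b hab t) :=
    hc.comp_continuous (continuous_subtype_val.comp continuous_projIcc) fun t =>
      (projIcc a b hab t).2
  let f : StieltjesFunction ℝ :=
    { toFun := fun t => m (projIcc a b hab t)
      mono' := fun s t hst => hm (projIcc a b hab s).2 (projIcc a b hab t).2
        (monotone_projIcc hab hst)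
      right_continuous' := fun t => hcont.continuousWithinAt }
  have hf : ∀ t ∈ Icc a b, f t = m t := fun t ht =>
    congrArg (fun z : Icc a b => m z) (projIcc_of_mem hab ht)
  refine ⟨f.measure, ?_, ⟨fun t => ?_⟩, fun u hu v hv huv => ?_⟩
  · refine f.isFiniteMeasure_of_forall_abs_le (C := |m a| + |m b|) fun t => ?_
    have h1 := hm (left_mem_Icc.2 hab) (projIcc a b hab t).2 (projIcc a b hab t).2.1
    have h2 := hm (projIcc a b hab t).2 (right_mem_Icc.2 hab) (projIcc a b hab t).2.2
    change |m (projIcc a b hab t)| ≤ _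
    rw [abs_le]
    constructor <;> linarith [neg_abs_le (m a), le_abs_self (m b), abs_nonneg (m a),
      abs_nonneg (m b)]
  · have : Function.leftLim f t = f t := hcont.continuousWithinAt.leftLim_eq
    rw [StieltjesFunction.measure_singleton, this, sub_self, ENNReal.ofReal_zero]
  · rw [Measure.real, StieltjesFunction.measure_Ioc, hf u hu, hf v hv,
      ENNReal.toReal_ofReal (sub_nonneg.2 (hm hu hv huv))]

end measure

/-! ### Strong Riemann–Stieltjes integrability -/

/-- Strong form of Riemann–Stieltjes integrability: the indefinite integral `F` is approximated by
the Riemann–Stieltjes sums with an absolute error summed over the subintervals. -/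
def HasStrongRSIntegral (f c F : ℝ → ℝ) (a b : ℝ) : Prop :=
  ∀ ε > 0, ∃ δ > 0, ∀ n t ξ, IsTaggedPartition a b δ n t ξ →
    ∑ k ∈ Finset.range n,
      |F (t (k + 1)) - F (t k) - f (ξ k) * (c (t (k + 1)) - c (t k))| < ε

namespace HasStrongRSIntegral

variable {f c F h m H : ℝ → ℝ} {a b : ℝ}

theorem hasRSIntegral (hF : HasStrongRSIntegral f c F a b) :
    HasRSIntegral f c a b (F b - F a) := by
  intro ε hε
  obtain ⟨δ, hδ, hF⟩ := hF ε hε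
  refine ⟨δ, hδ, fun n t ξ h0 hn hk => ?_⟩
  refine lt_of_le_of_lt ?_ (hF n t ξ ⟨h0, hn, hk⟩)
  rw [← h0, ← hn, ← Finset.sum_range_sub (fun k => F (t k)), ← Finset.sum_sub_distrib]
  refine (Finset.abs_sum_le_sum_abs _ _).trans (Finset.sum_le_sum fun k _ => ?_)
  rw [abs_sub_comm]

/-- A comparison integral with zero error, used to dominate ∫ x dc by C times the variation of c
when |x| ≤ C. -/
theorem of_const_left (C : ℝ) (m : ℝ → ℝ) (a b : ℝ) :
    HasStrongRSIntegral (fun _ => C) m (fun t => C * m t) a b :=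
  fun ε hε => ⟨1, one_pos, fun n t ξ _ => by simpa [mul_sub] using hε⟩

/-- Compare the two Riemann–Stieltjes sums termwise on a common partition with common tags, each
carrying total error below ε/2. -/
theorem abs_sub_le (hab : a ≤ b) (hF : HasStrongRSIntegral f c F a b)
    (hH : HasStrongRSIntegral h m H a b)
    (hle : ∀ p ∈ Icc a b, ∀ q ∈ Icc a b, p ≤ q → ∀ ξ ∈ Icc p q,
      |f ξ * (c q - c p)| ≤ h ξ * (m q - m p)) : |F b - F a| ≤ H b - H a := by
  refine le_of_forall_pos_lt_add fun ε hε => ?_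
  obtain ⟨δ, hδ, hF⟩ := hF (ε / 2) (by positivity)
  obtain ⟨δ', hδ', hH⟩ := hH (ε / 2) (by positivity)
  obtain ⟨n, t, ξ, hP⟩ := exists_isTaggedPartition hab (lt_min hδ hδ')
  have h1 := hF n t ξ (hP.mono (min_le_left _ _))
  have h2 := hH n t ξ (hP.mono (min_le_right _ _))
  rw [← hP.1, ← hP.2.1, ← Finset.sum_range_sub (fun k => F (t k)),
    ← Finset.sum_range_sub (fun k => H (t k))]
  refine lt_of_le_of_lt (Finset.abs_sum_le_sum_abs _ _) ?_
  have key : ∑ k ∈ Finset.range n, |F (t (k + 1)) - F (t k)| ≤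
      ∑ k ∈ Finset.range n, (H (t (k + 1)) - H (t k)) +
      (∑ k ∈ Finset.range n, |F (t (k + 1)) - F (t k) - f (ξ k) * (c (t (k + 1)) - c (t k))| +
      ∑ k ∈ Finset.range n, |H (t (k + 1)) - H (t k) - h (ξ k) * (m (t (k + 1)) - m (t k))|) := by
    rw [← Finset.sum_add_distrib, ← Finset.sum_add_distrib]
    refine Finset.sum_le_sum fun k hk => ?_
    have hk := Finset.mem_range.1 hk
    have h3 := hle _ (hP.mem_Icc hk.le) _ (hP.mem_Icc (Nat.succ_le_of_lt hk))
      (hP.2.2 k hk).1.le (ξ k) (hP.2.2 k hk).2.2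
    have h4 := abs_sub_abs_le_abs_sub (F (t (k + 1)) - F (t k))
      (f (ξ k) * (c (t (k + 1)) - c (t k)))
    have h5 := neg_abs_le (H (t (k + 1)) - H (t k) - h (ξ k) * (m (t (k + 1)) - m (t k)))
    linarith
  linarith

end HasStrongRSIntegral

/-! ### Integrals against a continuous integrator -/

section continuous

variable {a b : ℝ} {x c : ℝ → ℝ}

/-- With V the variation of c, the identity c = V - (V - c) gives measures μ₁, μ₂, and F is the
difference of the integrals of x. On each piece the error is at most the integral of |x - x(ξ)| for
μ₁ + μ₂. One F, anchored at a, serves all subintervals. -/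
theorem SigmaContinuousOn.exists_hasStrongRSIntegral (hab : a ≤ b) (hx : SigmaContinuousOn x a b)
    (hc : ContinuousOn c (Icc a b)) (hcv : BoundedVariationOn c (Icc a b)) :
    ∃ F : ℝ → ℝ, F a = 0 ∧ ∀ u ∈ Icc a b, ∀ v ∈ Icc a b, HasStrongRSIntegral x c F u v := by
  have ha : a ∈ Icc a b := left_mem_Icc.2 hab
  have hVc := continuousOn_variationOnFromTo hc hcv
  obtain ⟨μ₁, _, _, h₁⟩ := (variationOnFromTo.monotoneOn hcv.locallyBoundedVariationOn
    ha).exists_measure hab hVc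
  obtain ⟨μ₂, _, _, h₂⟩ := (variationOnFromTo.sub_self_monotoneOn hcv.locallyBoundedVariationOn
    ha).exists_measure hab (hVc.sub hc)
  have hi₁ := hx.integrableOn μ₁
  have hi₂ := hx.integrableOn μ₂
  have hsplit : ∀ (μ : Measure ℝ), IntegrableOn x (Icc a b) μ → ∀ u ∈ Icc a b, ∀ v ∈ Icc a b,
      u ≤ v → (∫ y in Ioc a v, x y ∂μ) - ∫ y in Ioc a u, x y ∂μ = ∫ y in Ioc u v, x y ∂μ := by
    intro μ hi u hu v hv huv
    rw [← Ioc_union_Ioc_eq_Ioc hu.1 huv, setIntegral_union (Ioc_disjoint_Ioc_of_le le_rfl)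
      measurableSet_Ioc (hi.mono_set (Ioc_subset_Icc_self.trans (Icc_subset_Icc le_rfl hu.2)))
      (hi.mono_set (Ioc_subset_Icc_self.trans (Icc_subset_Icc hu.1 hv.2))), add_sub_cancel_left]
  refine ⟨fun t => (∫ y in Ioc a t, x y ∂μ₁) - ∫ y in Ioc a t, x y ∂μ₂, by simp,
    fun u hu v hv ε hε => ?_⟩
  have : NullSingletonClass (μ₁ + μ₂) := ⟨fun s => by simp⟩
  obtain ⟨δ, hδ, hlt⟩ :=
    (hx.mono hu.1 hv.2).exists_sum_setIntegral_lt (μ₁ + μ₂) hε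
  refine ⟨δ, hδ, fun n t ξ hP => lt_of_le_of_lt (Finset.sum_le_sum fun k hk => ?_) (hlt n t ξ hP)⟩
  have hk := Finset.mem_range.1 hk
  have hsub : Icc u v ⊆ Icc a b := Icc_subset_Icc hu.1 hv.2
  have hp := hsub (hP.mem_Icc hk.le)
  have hq := hsub (hP.mem_Icc (Nat.succ_le_of_lt hk))
  have hpq := (hP.2.2 k hk).1.le
  set p := t k
  set q := t (k + 1)
  have hsub' : Ioc p q ⊆ Icc a b := Ioc_subset_Icc_self.trans (Icc_subset_Icc hp.1 hq.2)
  have hd₁ : IntegrableOn (fun y => x y - x (ξ k)) (Ioc p q) μ₁ :=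
    (hi₁.mono_set hsub').sub (integrable_const _)
  have hd₂ : IntegrableOn (fun y => x y - x (ξ k)) (Ioc p q) μ₂ :=
    (hi₂.mono_set hsub').sub (integrable_const _)
  have e₁ : ∫ y in Ioc p q, (x y - x (ξ k)) ∂μ₁ = (∫ y in Ioc p q, x y ∂μ₁) -
      μ₁.real (Ioc p q) * x (ξ k) := by
    rw [integral_sub (hi₁.mono_set hsub') (integrable_const _), setIntegral_const, smul_eq_mul]
  have e₂ : ∫ y in Ioc p q, (x y - x (ξ k)) ∂μ₂ = (∫ y in Ioc p q, x y ∂μ₂) -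
      μ₂.real (Ioc p q) * x (ξ k) := by
    rw [integral_sub (hi₂.mono_set hsub') (integrable_const _), setIntegral_const, smul_eq_mul]
  have hs₁ := hsplit μ₁ hi₁ p hp q hq hpq
  have hs₂ := hsplit μ₂ hi₂ p hp q hq hpq
  have hm₁ := h₁ p hp q hq hpq
  have hm₂ := h₂ p hp q hq hpq
  simp only [Pi.sub_apply] at hm₂
  have hc' : c q - c p = μ₁.real (Ioc p q) - μ₂.real (Ioc p q) := by
    rw [hm₁, hm₂]
    ring
  rw [Measure.restrict_add, integral_add_measure hd₁.abs hd₂.abs, hc']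
  rw [show ((∫ y in Ioc a q, x y ∂μ₁) - ∫ y in Ioc a q, x y ∂μ₂) -
      ((∫ y in Ioc a p, x y ∂μ₁) - ∫ y in Ioc a p, x y ∂μ₂) -
      x (ξ k) * (μ₁.real (Ioc p q) - μ₂.real (Ioc p q)) =
      (∫ y in Ioc p q, (x y - x (ξ k)) ∂μ₁) - ∫ y in Ioc p q, (x y - x (ξ k)) ∂μ₂ by
    rw [e₁, e₂, ← hs₁, ← hs₂]
    ring]
  exact (abs_sub _ _).trans (add_le_add abs_integral_le_integral_abs abs_integral_le_integral_abs)

theorem sum_edist_eq_ofReal (G : ℝ → ℝ) (t : ℕ → ℝ) (n : ℕ) :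
    ∑ k ∈ Finset.range n, edist (G (t (k + 1))) (G (t k)) =
      ENNReal.ofReal (∑ k ∈ Finset.range n, |G (t (k + 1)) - G (t k)|) := by
  rw [ENNReal.ofReal_sum_of_nonneg fun _ _ => abs_nonneg _]
  exact Finset.sum_congr rfl fun k _ => by rw [edist_dist, Real.dist_eq]

theorem BoundedVariationOn.sum_abs_sub_le {G : ℝ → ℝ} (hG : BoundedVariationOn G (Icc a b))
    {δ : ℝ} {n : ℕ} {t ξ : ℕ → ℝ} (hP : IsTaggedPartition a b δ n t ξ) :
    ∑ k ∈ Finset.range n, |G (t (k + 1)) - G (t k)| ≤ (eVariationOn G (Icc a b)).toReal := by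
  rw [← ENNReal.ofReal_le_iff_le_toReal hG, ← sum_edist_eq_ofReal]
  exact eVariationOn.sum_le_of_monotoneOn_Iic hP.monotoneOn fun i hi => hP.mem_Icc hi

/-- The sums of the increments of a continuous function over uniform partitions approximate its
variation. -/
theorem ContinuousOn.eventually_lt_sum_uniform (hab : a < b) (hc : ContinuousOn c (Icc a b))
    {s : ℝ} (hs : s < (eVariationOn c (Icc a b)).toReal) :
    ∀ᶠ N : ℕ in atTop, s < ∑ k ∈ Finset.range (N + 1),
      |c (a + (k + 1 : ℕ) * ((b - a) / (N + 1))) - c (a + k * ((b - a) / (N + 1)))| := by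
  rcases lt_or_ge s 0 with hs0 | hs0
  · exact Eventually.of_forall fun N => hs0.trans_le (Finset.sum_nonneg fun _ _ => abs_nonneg _)
  have hs' : ENNReal.ofReal s < eVariationOn c (Icc a b) := by
    rcases eq_or_ne (eVariationOn c (Icc a b)) ⊤ with h | h
    · rw [h]
      exact ENNReal.ofReal_lt_top
    · exact (ENNReal.ofReal_lt_iff_lt_toReal hs0 h).2 hs
  have hpos : ∀ N : ℕ, 0 < (b - a) / (N + 1 : ℝ) :=
    fun N => div_pos (sub_pos.2 hab) (by positivity)
  -- Rounding down to the grid: c ∘ φ N tends to c pointwise, so lower semicontinuity bounds the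
  -- variation of c. Since φ N is monotone with values in the grid, the variation of c ∘ φ N is at
  -- most the grid sum.
  set φ : ℕ → ℝ → ℝ := fun N t =>
    a + ⌊(t - a) / ((b - a) / (N + 1))⌋₊ * ((b - a) / (N + 1)) with hφ
  have hle : ∀ N, ∀ t ∈ Icc a b, φ N t ≤ t ∧ t - φ N t ≤ (b - a) / (N + 1) := by
    intro N t ht
    have h1 := Nat.floor_le (div_nonneg (sub_nonneg.2 ht.1) (hpos N).le)
    have h2 := (Nat.lt_floor_add_one ((t - a) / ((b - a) / (N + 1 : ℝ)))).le
    rw [le_div_iff₀ (hpos N)] at h1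
    rw [div_le_iff₀ (hpos N)] at h2
    constructor
    · simp only [hφ]; linarith
    · simp only [hφ]; linarith
  have hmem : ∀ N, ∀ t ∈ Icc a b, φ N t ∈ Icc a b := fun N t ht =>
    ⟨le_add_of_nonneg_right (mul_nonneg (Nat.cast_nonneg _) (hpos N).le),
      (hle N t ht).1.trans ht.2⟩
  have hlim : ∀ t ∈ Icc a b, Tendsto (fun N => (c ∘ φ N) t) atTop (𝓝 (c t)) := by
    intro t ht
    refine (hc t ht).tendsto.comp (tendsto_nhdsWithin_iff.2
      ⟨?_, Eventually.of_forall fun N => hmem N t ht⟩)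
    rw [Metric.tendsto_nhds]
    intro ε hε
    filter_upwards [eventually_div_lt a b hε] with N hN
    rw [Real.dist_eq, abs_lt]
    have := hle N t ht
    constructor <;> linarith
  filter_upwards [eVariationOn.lowerSemicontinuous_aux hlim hs'] with N hN
  set t : ℕ → ℝ := fun k => a + k * ((b - a) / (N + 1)) with ht
  have htm : Monotone t := fun i j hij => by
    simp only [ht]
    gcongr
  have hφm : MonotoneOn (φ N) (Icc a b) := fun u _ v _ huv => by
    simp only [hφ]
    gcongr
  have himg : φ N '' Icc a b ⊆ t '' Iic (N + 1) := by
    rintro _ ⟨u, hu, rfl⟩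
    refine ⟨⌊(u - a) / ((b - a) / (N + 1 : ℝ))⌋₊, ?_, rfl⟩
    refine mem_Iic.2 (Nat.floor_le_of_le ?_)
    rw [div_le_iff₀ (hpos N)]
    push_cast
    have : (N + 1 : ℝ) * ((b - a) / (N + 1)) = b - a := by field_simp
    linarith [hu.2]
  rw [eVariationOn.comp_eq_of_monotoneOn _ _ hφm] at hN
  have hN' := hN.trans_le ((eVariationOn.mono c himg).trans_eq
    (eVariationOn.image_range_of_monotone c htm (N + 1)))
  simp only [edist_comm (c (t _)) (c (t (_ + 1)))] at hN'
  rw [sum_edist_eq_ofReal] at hN'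
  exact (ENNReal.ofReal_lt_ofReal_iff_of_nonneg hs0).1 hN'

/-- The variation of the indefinite Riemann–Stieltjes integral with respect to a continuous
function of bounded variation. -/
theorem HasStrongRSIntegral.variation_eq (hab : a < b) {F H : ℝ → ℝ} {C : ℝ}
    (hC : ∀ t ∈ Icc a b, |x t| ≤ C) (hc : ContinuousOn c (Icc a b))
    (hcv : BoundedVariationOn c (Icc a b))
    (hF : ∀ u ∈ Icc a b, ∀ v ∈ Icc a b, HasStrongRSIntegral x c F u v)
    (hH : ∀ u ∈ Icc a b, ∀ v ∈ Icc a b,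
      HasStrongRSIntegral (fun t => |x t|) (variationOnFromTo c (Icc a b) a) H u v) :
    ContinuousOn F (Icc a b) ∧ BoundedVariationOn F (Icc a b) ∧
      variationOnFromTo F (Icc a b) a b = H b - H a := by
  have ha : a ∈ Icc a b := left_mem_Icc.2 hab.le
  have hb : b ∈ Icc a b := right_mem_Icc.2 hab.le
  set V := variationOnFromTo c (Icc a b) a with hV
  have hcV : ∀ u ∈ Icc a b, ∀ v ∈ Icc a b, u ≤ v → |c v - c u| ≤ V v - V u := fun u hu v hv huv =>
    variationOnFromTo.abs_sub_le_sub_of_le hcv.locallyBoundedVariationOn ha hu hv huv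
  have hFH : ∀ u ∈ Icc a b, ∀ v ∈ Icc a b, u ≤ v → |F v - F u| ≤ H v - H u := by
    intro u hu v hv huv
    have hsub : Icc u v ⊆ Icc a b := Icc_subset_Icc hu.1 hv.2
    refine (hF u hu v hv).abs_sub_le huv (hH u hu v hv) fun p hp q hq hpq ξ _ => ?_
    rw [abs_mul]
    exact mul_le_mul_of_nonneg_left (hcV p (hsub hp) q (hsub hq) hpq) (abs_nonneg _)
  have hFC : ∀ u ∈ Icc a b, ∀ v ∈ Icc a b, u ≤ v → |F v - F u| ≤ C * V v - C * V u := by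
    intro u hu v hv huv
    have hsub : Icc u v ⊆ Icc a b := Icc_subset_Icc hu.1 hv.2
    refine (hF u hu v hv).abs_sub_le huv (.of_const_left C V u v) fun p hp q hq hpq ξ hξ => ?_
    rw [abs_mul]
    exact mul_le_mul (hC ξ (hsub ⟨hp.1.trans hξ.1, hξ.2.trans hq.2⟩))
      (hcV p (hsub hp) q (hsub hq) hpq) (abs_nonneg _) ((abs_nonneg _).trans (hC a ha))
  have hFv : BoundedVariationOn F (Icc a b) := boundedVariationOn_Icc_of_abs_sub_le hFC hab.le
  refine ⟨?_, hFv, le_antisymm (variationOnFromTo_Icc_le hFH hb) ?_⟩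
  · have hVc : ContinuousOn V (Icc a b) := continuousOn_variationOnFromTo hc hcv
    intro u hu
    have h0 : Tendsto (fun v => |C * V v - C * V u|) (𝓝[Icc a b] u) (𝓝 0) := by
      have := ((Tendsto.const_mul C (hVc u hu)).sub_const (C * V u)).abs
      rwa [sub_self, abs_zero] at this
    rw [ContinuousWithinAt, tendsto_iff_dist_tendsto_zero]
    refine squeeze_zero' (Eventually.of_forall fun _ => dist_nonneg) ?_ h0
    filter_upwards [self_mem_nhdsWithin] with v hv
    rw [Real.dist_eq]
    rcases le_total u v with huv | huv
    · exact (hFC u hu v hv huv).trans (le_abs_self _)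
    · rw [abs_sub_comm, abs_sub_comm (C * V v)]
      exact (hFC v hv u hu huv).trans (le_abs_self _)
  · rw [variationOnFromTo_Icc hb]
    have hC0 : 0 ≤ C := (abs_nonneg _).trans (hC a ha)
    refine le_of_forall_pos_le_add fun ε hε => ?_
    -- The three errors are η for F, η for H, and C·η for replacing ΔV by |Δc|.
    obtain ⟨η, hη, hηε⟩ : ∃ η > 0, (C + 2) * η ≤ ε :=
      ⟨ε / (C + 2), by positivity, by rw [mul_div_cancel₀ _ (by positivity)]⟩
    obtain ⟨δ, hδ, hF⟩ := hF a ha b hb η hη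
    obtain ⟨δ', hδ', hH⟩ := hH a ha b hb η hη
    obtain ⟨N, hN, hsum⟩ := ((eventually_div_lt a b (lt_min hδ hδ')).and
      (hc.eventually_lt_sum_uniform hab (sub_lt_self _ hη))).exists
    set t : ℕ → ℝ := fun k => a + k * ((b - a) / (N + 1)) with ht
    have hP : IsTaggedPartition a b (min δ δ') (N + 1) t t :=
      IsTaggedPartition.uniform hab N hN
    have h1 := hF _ _ _ (hP.mono (min_le_left _ _))
    have h2 := hH _ _ _ (hP.mono (min_le_right _ _))
    have h3 := hFv.sum_abs_sub_le hP
    simp only at h2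
    have hVb : (eVariationOn c (Icc a b)).toReal = V b - V a := by
      rw [hV, variationOnFromTo.self, variationOnFromTo_Icc hb, sub_zero]
    rw [hVb] at hsum
    change _ < ∑ k ∈ Finset.range (N + 1), |c (t (k + 1)) - c (t k)| at hsum
    have hVs : V b - V a = ∑ k ∈ Finset.range (N + 1), (V (t (k + 1)) - V (t k)) := by
      rw [Finset.sum_range_sub (fun k => V (t k)), hP.1, hP.2.1]
    have hHs : H b - H a = ∑ k ∈ Finset.range (N + 1), (H (t (k + 1)) - H (t k)) := by
      rw [Finset.sum_range_sub (fun k => H (t k)), hP.1, hP.2.1]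
    -- Termwise, ΔH ≈ |x|ΔV ≤ |x||Δc| + C(ΔV - |Δc|), and |x||Δc| ≈ |ΔF|.
    have key : ∑ k ∈ Finset.range (N + 1), (H (t (k + 1)) - H (t k)) ≤
        ∑ k ∈ Finset.range (N + 1), |F (t (k + 1)) - F (t k)| +
        ∑ k ∈ Finset.range (N + 1),
          |F (t (k + 1)) - F (t k) - x (t k) * (c (t (k + 1)) - c (t k))| +
        ∑ k ∈ Finset.range (N + 1),
          |H (t (k + 1)) - H (t k) - |x (t k)| * (V (t (k + 1)) - V (t k))| +
        C * (∑ k ∈ Finset.range (N + 1), (V (t (k + 1)) - V (t k)) -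
          ∑ k ∈ Finset.range (N + 1), |c (t (k + 1)) - c (t k)|) := by
      rw [← Finset.sum_sub_distrib, Finset.mul_sum, ← Finset.sum_add_distrib,
        ← Finset.sum_add_distrib, ← Finset.sum_add_distrib]
      refine Finset.sum_le_sum fun k hk => ?_
      have hk := Finset.mem_range.1 hk
      have hp := hP.mem_Icc hk.le
      have h4 := le_abs_self (H (t (k + 1)) - H (t k) - |x (t k)| * (V (t (k + 1)) - V (t k)))
      have h5 := abs_sub_abs_le_abs_sub (x (t k) * (c (t (k + 1)) - c (t k)))
        (F (t (k + 1)) - F (t k))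
      rw [abs_mul, abs_sub_comm (x (t k) * _)] at h5
      have h6 := mul_le_mul_of_nonneg_right (hC _ hp) (sub_nonneg.2 (hcV _ hp _
        (hP.mem_Icc (show k + 1 ≤ N + 1 from hk)) (hP.2.2 k hk).1.le))
      linarith
    have h7 : C * (∑ k ∈ Finset.range (N + 1), (V (t (k + 1)) - V (t k)) -
        ∑ k ∈ Finset.range (N + 1), |c (t (k + 1)) - c (t k)|) ≤ C * η :=
      mul_le_mul_of_nonneg_left (by linarith) hC0
    linarith

end continuous

/-! ### The *-integral in terms of the jump decomposition -/

theorem HasStrongRSIntegral.congr {f c c' F : ℝ → ℝ} {a b : ℝ}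
    (h : HasStrongRSIntegral f c F a b) (hc : EqOn c c' (Icc a b)) :
    HasStrongRSIntegral f c' F a b := by
  intro ε hε
  obtain ⟨δ, hδ, h⟩ := h ε hε
  refine ⟨δ, hδ, fun n t ξ hP => ?_⟩
  have := h n t ξ hP
  rwa [Finset.sum_congr rfl fun k hk => by
    rw [hc (hP.mem_Icc (Finset.mem_range.1 hk).le),
      hc (hP.mem_Icc (Nat.succ_le_of_lt (Finset.mem_range.1 hk)))]] at this

theorem varFun_eq_variationOnFromTo {g : ℝ → ℝ} {a b t : ℝ} (ht : t ∈ Icc a b) :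
    varFun g a t = variationOnFromTo g (Icc a b) a t := by
  rcases ht.1.eq_or_lt with rfl | hat
  · simp [varFun, variationOnFromTo.self]
  · rw [varFun, if_neg hat.not_ge, variationOnFromTo_Icc ht, totalVar]

theorem HasJumps.jumpRight_eq {G l r : ℝ → ℝ} {a b t : ℝ} (h : HasJumps G l r a b)
    (ht : t ∈ Ico a b) : jumpRight G t = r t := by
  rw [jumpRight, rightLim_eq_of_tendsto (h.right t ht), add_sub_cancel_left]

theorem HasJumps.jumpLeft_eq {G l r : ℝ → ℝ} {a b t : ℝ} (h : HasJumps G l r a b)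
    (ht : t ∈ Ioc a b) : jumpLeft G t = l t := by
  rw [jumpLeft, leftLim_eq_of_tendsto (h.left t ht), sub_sub_cancel]

theorem jump_eq_add (G : ℝ → ℝ) (t : ℝ) : jump G t = jumpRight G t + jumpLeft G t := by
  rw [jump, jumpRight, jumpLeft]
  ring

theorem summable_mul_of_abs_le {f l : ℝ → ℝ} {s : Set ℝ} {C : ℝ} (hl : Summable l)
    (hf : ∀ t ∈ s, |f t| ≤ C) (h0 : ∀ t ∉ s, l t = 0) : Summable fun t => f t * l t := by
  refine (hl.abs.mul_left C).of_norm_bounded fun t => ?_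
  by_cases ht : t ∈ s
  · rw [Real.norm_eq_abs, abs_mul]
    exact mul_le_mul_of_nonneg_right (hf t ht) (abs_nonneg _)
  · simp [h0 t ht]

/-- `G = c + jumpFun l r` on `[a, b]`, where `c` is continuous and of bounded variation and the
jumps `l` and `r` are summable. -/
structure JumpDecomposition (G c l r : ℝ → ℝ) (a b : ℝ) : Prop where
  continuousOn : ContinuousOn c (Icc a b)
  boundedVariationOn : BoundedVariationOn c (Icc a b)
  summable_left : Summable l
  summable_right : Summable r
  left_eq_zero : ∀ t ∉ Ioc a b, l t = 0
  right_eq_zero : ∀ t ∉ Ico a b, r t = 0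
  eq_add : ∀ t ∈ Icc a b, G t = c t + jumpFun l r t

namespace JumpDecomposition

variable {G c l r f : ℝ → ℝ} {a b t : ℝ}

theorem hasJumps (h : JumpDecomposition G c l r a b) : HasJumps G l r a b := by
  have := h.continuousOn.hasJumps_zero.add
    (hasJumps_jumpFun h.summable_left h.summable_right h.left_eq_zero h.right_eq_zero)
  simp only [zero_add] at this
  exact this.congr fun t ht => (h.eq_add t ht).symm

theorem boundedVariationOn_and_variation (h : JumpDecomposition G c l r a b) (hab : a ≤ b) :
    BoundedVariationOn G (Icc a b) ∧ ∀ t ∈ Icc a b, variationOnFromTo G (Icc a b) a t =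
      variationOnFromTo c (Icc a b) a t + jumpFun (fun s => |l s|) (fun s => |r s|) t := by
  have hG : EqOn (fun t => c t + jumpFun l r t) G (Icc a b) := fun t ht => (h.eq_add t ht).symm
  obtain ⟨h1, h2⟩ := BoundedVariationOn.add_jumpFun hab h.continuousOn h.boundedVariationOn
    h.summable_left h.summable_right h.left_eq_zero h.right_eq_zero
  refine ⟨by rwa [BoundedVariationOn, eVariationOn.congr hG] at h1, fun t ht => ?_⟩
  rw [← h2 t ht, variationOnFromTo_Icc ht, variationOnFromTo_Icc ht,
    eVariationOn.congr (hG.mono (Icc_subset_Icc_right ht.2))]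

theorem varFun (h : JumpDecomposition G c l r a b) (hab : a ≤ b) :
    JumpDecomposition (varFun G a) (variationOnFromTo c (Icc a b) a)
      (fun s => |l s|) (fun s => |r s|) a b where
  continuousOn := continuousOn_variationOnFromTo h.continuousOn h.boundedVariationOn
  boundedVariationOn := boundedVariationOn_Icc_of_abs_sub_le
    (m := variationOnFromTo c (Icc a b) a) (fun u hu v hv huv => (abs_of_nonneg (sub_nonneg.2
      (variationOnFromTo.monotoneOn h.boundedVariationOn.locallyBoundedVariationOn
        (left_mem_Icc.2 hab) hu hv huv))).le) hab
  summable_left := h.summable_left.abs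
  summable_right := h.summable_right.abs
  left_eq_zero t ht := by rw [h.left_eq_zero t ht, abs_zero]
  right_eq_zero t ht := by rw [h.right_eq_zero t ht, abs_zero]
  eq_add t ht := by
    rw [varFun_eq_variationOnFromTo ht, (h.boundedVariationOn_and_variation hab).2 t ht]

theorem mul_jump_eq (h : JumpDecomposition G c l r a b) (ht : t ∈ Ioc a b) {s : ℝ}
    (hs : s ∈ Ioo a t) : f s * jump G s = f s * r s + f s * l s := by
  rw [jump_eq_add, h.hasJumps.jumpRight_eq ⟨hs.1.le, hs.2.trans_le ht.2⟩,
    h.hasJumps.jumpLeft_eq ⟨hs.1, hs.2.le.trans ht.2⟩, mul_add]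

theorem summable_mul_jump (h : JumpDecomposition G c l r a b) (ht : t ∈ Ioc a b)
    (hl : Summable fun s => f s * l s) (hr : Summable fun s => f s * r s) :
    Summable fun s : ↥(discSet G a t ∩ Ioo a t) => f s * jump G s := by
  refine ((hr.add hl).comp_injective Subtype.val_injective).congr fun s => ?_
  exact (h.mul_jump_eq ht s.2.2).symm

/-- The series over discontinuities extends to all reals because l and r vanish at interior
continuity points. The endpoint terms enter as one-point series, and only the right jump at a and
the left jump at t count. -/
theorem tsum_mul_jump (h : JumpDecomposition G c l r a b) (ht : t ∈ Ioc a b)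
    (hl : Summable fun s => f s * l s) (hr : Summable fun s => f s * r s) :
    f a * jumpRight G a + (∑' s : ↥(discSet G a t ∩ Ioo a t), f s * jump G s) +
      f t * jumpLeft G t = jumpFun (fun s => f s * l s) (fun s => f s * r s) t := by
  rw [h.hasJumps.jumpRight_eq ⟨le_rfl, ht.1.trans_le ht.2⟩, h.hasJumps.jumpLeft_eq ht,
    tsum_subtype (discSet G a t ∩ Ioo a t) fun s => f s * jump G s,
    ← tsum_ite_eq a (fun _ => f a * r a), ← tsum_ite_eq t (fun _ => f t * l t), jumpFun]
  have hsum : Summable ((discSet G a t ∩ Ioo a t).indicator fun s => f s * jump G s) :=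
    summable_subtype_iff_indicator.1 (h.summable_mul_jump ht hl hr)
  have hsa := (hasSum_ite_eq a (f a * r a)).summable
  have hst := (hasSum_ite_eq t (f t * l t)).summable
  rw [← hsa.tsum_add hsum, ← (hsa.add hsum).tsum_add hst]
  refine tsum_congr fun s => ?_
  have hind : (discSet G a t ∩ Ioo a t).indicator (fun s => f s * jump G s) s =
      if a < s ∧ s < t then f s * r s + f s * l s else 0 := by
    by_cases hs : s ∈ Ioo a t
    · rw [if_pos (show a < s ∧ s < t from hs)]
      by_cases hd : s ∈ discSet G a t
      · rw [indicator_of_mem (mem_inter hd hs), h.mul_jump_eq ht hs]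
      · have hcont : ContinuousWithinAt G (Icc a t) s :=
          not_not.1 fun h' => hd ⟨Ioo_subset_Icc_self hs, h'⟩
        -- An interior point of [a, t] has two-sided continuity there, so it does not matter that
        -- `discSet` refers to [a, t] and the jumps to [a, b].
        have hcont' := (hcont.continuousAt (Icc_mem_nhds hs.1 hs.2)).continuousWithinAt
          (s := Icc a b)
        obtain ⟨h1, h2⟩ := (h.hasJumps.continuousWithinAt_iff
          ⟨hs.1.le, hs.2.le.trans ht.2⟩).1 hcont'
        rw [indicator_of_notMem fun h' => hd h'.1, h1, h2]
        simp
    · rw [indicator_of_notMem fun h' => hs h'.2, if_neg (show ¬(a < s ∧ s < t) from hs)]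
  rw [hind]
  have h1 := h.left_eq_zero s
  have h2 := h.right_eq_zero s
  have hat := ht.1
  rcases lt_trichotomy s a with hsa | rfl | hsa
  · rw [h1 (by grind), h2 (by grind)]
    grind
  · rw [h1 (by grind)]
    grind
  · grind

/-- The previous identity with f = 1 computes the discrete part; both it and `jumpFun` vanish at a,
so no additive constant appears. -/
theorem contPart_eq (h : JumpDecomposition G c l r a b) (ht : t ∈ Icc a b) :
    contPart G a t = c t := by
  rw [contPart, h.eq_add t ht, discPart]
  rcases ht.1.eq_or_lt with rfl | hat
  · rw [if_pos le_rfl, jumpFun_left h.left_eq_zero h.right_eq_zero]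
    ring
  · have := h.tsum_mul_jump (f := fun _ => 1) ⟨hat, ht.2⟩ (by simpa using h.summable_left)
      (by simpa using h.summable_right)
    simp only [one_mul] at this
    rw [if_neg hat.not_ge, this]
    ring

theorem starIntegrable_and_starIntegral_eq (h : JumpDecomposition G c l r a b)
    (ht : t ∈ Ioc a b) (hl : Summable fun s => f s * l s) (hr : Summable fun s => f s * r s)
    {J : ℝ} (hJ : HasRSIntegral f c a t J) :
    StarIntegrable f G a t ∧
      starIntegral f G a t = J + jumpFun (fun s => f s * l s) (fun s => f s * r s) t := by
  have hJ' : HasRSIntegral f (contPart G a) a t J :=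
    hJ.congr fun s hs => (h.contPart_eq ⟨hs.1, hs.2.trans ht.2⟩).symm
  refine ⟨⟨⟨J, hJ'⟩, h.summable_mul_jump ht hl hr⟩, ?_⟩
  rw [starIntegral, if_pos ht.1, hJ'.rsIntegral_eq ht.1.le, h.tsum_mul_jump ht hl hr]

/-- The indefinite `*`-integral decomposes into the Riemann–Stieltjes integral with respect to the
continuous part and a pure jump function. -/
theorem starIntegral (h : JumpDecomposition G c l r a b) {C : ℝ}
    (hC : ∀ t ∈ Icc a b, |f t| ≤ C) {F : ℝ → ℝ} (hF0 : F a = 0)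
    (hF : ∀ t ∈ Ioc a b, HasRSIntegral f c a t (F t)) (hFc : ContinuousOn F (Icc a b))
    (hFv : BoundedVariationOn F (Icc a b)) :
    JumpDecomposition (fun t => starIntegral f G a t) F (fun s => f s * l s)
      (fun s => f s * r s) a b where
  continuousOn := hFc
  boundedVariationOn := hFv
  summable_left := summable_mul_of_abs_le h.summable_left
    (fun t ht => hC t (Ioc_subset_Icc_self ht)) h.left_eq_zero
  summable_right := summable_mul_of_abs_le h.summable_right
    (fun t ht => hC t (Ico_subset_Icc_self ht)) h.right_eq_zero
  left_eq_zero t ht := by rw [h.left_eq_zero t ht, mul_zero]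
  right_eq_zero t ht := by rw [h.right_eq_zero t ht, mul_zero]
  eq_add t ht := by
    rcases ht.1.eq_or_lt with rfl | hat
    · rw [_root_.starIntegral, if_neg (lt_irrefl _), hF0, jumpFun_left (a := a) (b := b), add_zero]
      · exact fun t ht => by rw [h.left_eq_zero t ht, mul_zero]
      · exact fun t ht => by rw [h.right_eq_zero t ht, mul_zero]
    · exact (h.starIntegrable_and_starIntegral_eq ⟨hat, ht.2⟩
        (summable_mul_of_abs_le h.summable_left
          (fun t ht => hC t (Ioc_subset_Icc_self ht)) h.left_eq_zero)
        (summable_mul_of_abs_le h.summable_right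
          (fun t ht => hC t (Ico_subset_Icc_self ht)) h.right_eq_zero)
        (hF t ⟨hat, ht.2⟩)).2

end JumpDecomposition

/-! ### Assembly -/

theorem totalVar_eq_variationOnFromTo {G : ℝ → ℝ} {a b : ℝ} (hab : a ≤ b) :
    totalVar G a b = variationOnFromTo G (Icc a b) a b := by
  rw [variationOnFromTo_Icc (right_mem_Icc.2 hab), totalVar]

theorem theorem14p8 (a b : ℝ) (hab : a < b) (x g : ℝ → ℝ)
    (hx : SigmaContinuousOn x a b) (hg : BoundedVariationOn g (Icc a b)) :
    (∀ t ∈ Ioc a b, StarIntegrable x g a t ∧ StarIntegrable x (varFun g a) a t) ∧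
    StarIntegrable (fun s => |x s|) (varFun g a) a b ∧
    BoundedVariationOn (fun t => starIntegral x g a t) (Icc a b) ∧
    BoundedVariationOn (fun t => starIntegral x (varFun g a) a t) (Icc a b) ∧
    totalVar (fun t => starIntegral x g a t) a b
      = totalVar (fun t => starIntegral x (varFun g a) a t) a b ∧
    totalVar (fun t => starIntegral x (varFun g a) a t) a b
      = starIntegral (fun s => |x s|) (varFun g a) a b := by
  obtain ⟨C, hC⟩ := hx.bounded
  have ha : a ∈ Icc a b := left_mem_Icc.2 hab.le
  have hb : b ∈ Icc a b := right_mem_Icc.2 hab.le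
  obtain ⟨c, l, r, hc, hcv, hl, hr, hl0, hr0, hgeq⟩ := hg.exists_eq_add_jumpFun hab.le
  have D : JumpDecomposition g c l r a b := ⟨hc, hcv, hl, hr, hl0, hr0, fun t _ => hgeq t⟩
  have Dπ := D.varFun hab.le
  set V := variationOnFromTo c (Icc a b) a with hV
  -- V increases from 0, hence is its own variation; the single function H = ∫ |x| dV can therefore
  -- be compared with both F and K.
  have hVV : EqOn V (variationOnFromTo V (Icc a b) a) (Icc a b) := by
    intro t ht
    have hVm : MonotoneOn V (Icc a b) :=
      variationOnFromTo.monotoneOn hcv.locallyBoundedVariationOn ha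
    have hVa : V a = 0 := variationOnFromTo.self _ _ _
    rw [variationOnFromTo.eq_of_le _ _ ht.1, hVm.eVariationOn_eq ha ht, hVa, sub_zero,
      ENNReal.toReal_ofReal (hVa ▸ hVm ha ht ht.1)]
  obtain ⟨F, hF0, hF⟩ := hx.exists_hasStrongRSIntegral hab.le hc hcv
  obtain ⟨K, hK0, hK⟩ := hx.exists_hasStrongRSIntegral hab.le Dπ.continuousOn
    Dπ.boundedVariationOn
  obtain ⟨H, hH0, hH⟩ := hx.abs.exists_hasStrongRSIntegral hab.le Dπ.continuousOn
    Dπ.boundedVariationOn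
  obtain ⟨hFc, hFv, hFV⟩ := HasStrongRSIntegral.variation_eq hab hC hc hcv hF hH
  obtain ⟨hKc, hKv, hKV⟩ := HasStrongRSIntegral.variation_eq hab hC Dπ.continuousOn
    Dπ.boundedVariationOn hK fun u hu v hv =>
      (hH u hu v hv).congr (hVV.mono (Icc_subset_Icc hu.1 hv.2))
  have hFrs : ∀ t ∈ Ioc a b, HasRSIntegral x c a t (F t) := fun t ht => by
    simpa [hF0] using (hF a ha t (Ioc_subset_Icc_self ht)).hasRSIntegral
  have hKrs : ∀ t ∈ Ioc a b, HasRSIntegral x V a t (K t) := fun t ht => by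
    simpa [hK0] using (hK a ha t (Ioc_subset_Icc_self ht)).hasRSIntegral
  have hHrs : HasRSIntegral (fun s => |x s|) V a b (H b) := by
    simpa [hH0] using (hH a ha b hb).hasRSIntegral
  have DΦ := D.starIntegral hC hF0 hFrs hFc hFv
  have DΨ := Dπ.starIntegral hC hK0 hKrs hKc hKv
  obtain ⟨hΦv, hΦ⟩ := DΦ.boundedVariationOn_and_variation hab.le
  obtain ⟨hΨv, hΨ⟩ := DΨ.boundedVariationOn_and_variation hab.le
  have habs := Dπ.starIntegrable_and_starIntegral_eq (f := fun s => |x s|) (right_mem_Ioc.2 hab)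
    (by simpa only [abs_mul, abs_abs] using DΨ.summable_left.abs)
    (by simpa only [abs_mul, abs_abs] using DΨ.summable_right.abs) hHrs
  refine ⟨fun t ht => ⟨?_, ?_⟩, habs.1, hΦv, hΨv, ?_, ?_⟩
  · exact (D.starIntegrable_and_starIntegral_eq ht DΦ.summable_left DΦ.summable_right
      (hFrs t ht)).1
  · exact (Dπ.starIntegrable_and_starIntegral_eq ht DΨ.summable_left DΨ.summable_right
      (hKrs t ht)).1
  -- The continuous parts both vary by H b - H a, and the jumps agree in absolute value since |x·l|
  -- = |x·|l||, likewise for r.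
  · rw [totalVar_eq_variationOnFromTo hab.le, totalVar_eq_variationOnFromTo hab.le, hΦ b hb,
      hΨ b hb, hFV, hKV]
    simp only [abs_mul, abs_abs]
  · rw [totalVar_eq_variationOnFromTo hab.le, hΨ b hb, habs.2, hKV, hH0, sub_zero]
    simp only [abs_mul, abs_abs]
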